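/- Let $m>0$, $b=1/m$, $K\in\mathbb R$, let $f_L,\Delta_1:\mathbb R^2\to\mathbb R$ and $\Delta_2:\mathbb R\to\mathbb R$ be continuously differentiable, and consider the control system with state $x=(x_1,x_2)\in\mathbb R^2$ and scalar input $u$ $$\dot x_1=x_2,\qquad \dot x_2=\tfrac1m\bigl(f_L(x)-Kx_1\bigr)+\Delta_1(x)+\bigl(b+\Delta_2(u)\bigr)u ,$$ that is, $\dot x=f(x)+g_u(x)\,u$ with $f(x)=\bigl(x_2,\ \tfrac1m(f_L(x)-Kx_1)+\Delta_1(x)\bigr)$ and $g_u(x)=\bigl(0,\ b+\Delta_2(u)\bigr)$. For vector fields on $\mathbb R^2$ write $[f,g]=\frac{\partial f}{\partial x}g-\frac{\partial g}{\partial x}f$ (brackets are taken in $x$, with $u$ fixed). A trajectory on $[0,T]$ is a pair $(x,u)$ with $u$ continuous on $[0,T]$ and $x$ a classical solution there. (1) For all $x\in\mathbb R^2$, $u\in\mathbb R$, $$[f,g_u](x)=\begin{pmatrix} b+\Delta_2(u)\\ (b+\Delta_2(u))\left(\frac1m\frac{\partial f_L}{\partial x_2}(x)+\frac{\partial\Delta_1}{\partial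 x_2}(x)\right)\end{pmatrix},$$ and $M=\bigl[\,g_u(x)\ \ [f,g_u](x)\,\bigr]$ satisfies $\det M=-(b+\Delta_2(u))^2$. With the opposite sign convention for the bracket the determinant is $+(b+\Delta_2(u))^2$. With either convention, $M$ has full rank $2$ if and only if $\Delta_2(u)\ne -b$. (2) If $\Delta_2(u)\neq -b$ for some $u$, then the system is locally weakly controllable, in the sense of Hermann and Krener, at every $x_0\in\mathbb R^2$: for every neighbourhood $U$ of $x_0$, the class of $x_0$ under the equivalence relation generated by "$c$ is reachable from $a$ by a trajectory that stays in $U$" is a neighbourhood of $x_0$. (3) If $\Delta_2(0)\ne -b$, then the system is locally controllable along each of its unforced motions: if $T>0$ and $(\bar x,\bar u)$ with $\bar u\equiv 0$ is a trajectory on $[0,T]$, then for every $\varepsilon>0$ there is $\delta>0$ such that any $a,c$ with $|a-\bar x(0)|<\delta$, $|c-\bar x(T)|<\delta$ are joined by a trajectory $(x,u)$ on $[0,T]$ with $x(0)=a$, $x(T)=c$, and $|x(t)-\bar x(t)|<\varepsilon$, $|u(t)-\bar u(t)|<\varepsilon$ for all $t\in[0,T]$. Moreover, it is locally controllable at every $x_0$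 with $f(x_0)=0$: for every neighbourhood $U$ of $x_0$, the points reachable from $x_0$ by trajectories that stay in $U$ form a neighbourhood of $x_0$. (4) If $\Delta_2$ is constant and different from $-b$ (so that the system is affine in $u$), then the system is locally controllable along each of its trajectories $(\bar x,\bar u)$ on $[0,T]$, $T>0$ (in the sense of (3)), and locally controllable at every $x_0=(x_1,x_2)$ with $x_2=0$. -/

import Mathlib

open Set Topology

section ControlSystems

variable {E : Type*} [NormedAddCommGroup E] [NormedSpace ℝ E]

/-- `(x, u)` is a trajectory on `[0, T]` of the scalar-input control system `x' = F x u`: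
the input `u` is continuous and `x` is a classical solution (one-sided at the end points). -/
def IsTrajectory (F : E → ℝ → E) (T : ℝ) (x : ℝ → E) (u : ℝ → ℝ) : Prop :=
  ContinuousOn u (Icc 0 T) ∧
    ∀ t ∈ Icc 0 T, HasDerivWithinAt x (F (x t) (u t)) (Icc 0 T) t

/-- `c` can be reached from `a`, in some time, by a trajectory that stays in `U`. -/
def ReachableWithin (F : E → ℝ → E) (U : Set E) (a c : E) : Prop :=
  ∃ T : ℝ, 0 ≤ T ∧ ∃ (x : ℝ → E) (u : ℝ → ℝ),
    IsTrajectory F T x u ∧ x 0 = a ∧ x T = c ∧ ∀ t ∈ Icc 0 T, x t ∈ U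

/-- Local controllability at a point in the sense of Hermann and Krener: for every neighbourhood
`U` of `x₀`, the points reachable from `x₀` inside `U` form a neighbourhood of `x₀`. -/
def LocallyControllableAt (F : E → ℝ → E) (x₀ : E) : Prop :=
  ∀ U ∈ 𝓝 x₀, {c | ReachableWithin F U x₀ c} ∈ 𝓝 x₀

/-- Local weak controllability at a point in the sense of Hermann and Krener: as above, with
reachability inside `U` replaced by the equivalence relation that it generates (trajectories inside
`U` may be followed forwards and backwards in time). -/
def LocallyWeaklyControllableAt (F : E → ℝ → E) (x₀ : E) : Prop :=
  ∀ U ∈ 𝓝 x₀, {c | Relation.EqvGen (ReachableWithin F U) x₀ c} ∈ 𝓝 x₀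

/-- Local controllability along the trajectory `(xr, ur)` on `[0, T]`: every point near `xr 0` can
be steered, in time `T`, to every point near `xr T`, with state and input uniformly close to the
reference. -/
def LocallyControllableAlong (F : E → ℝ → E) (T : ℝ) (xr : ℝ → E) (ur : ℝ → ℝ) : Prop :=
  ∀ ε > 0, ∃ δ > 0, ∀ a c : E, dist a (xr 0) < δ → dist c (xr T) < δ →
    ∃ (x : ℝ → E) (u : ℝ → ℝ), IsTrajectory F T x u ∧ x 0 = a ∧ x T = c ∧
      ∀ t ∈ Icc 0 T, dist (x t) (xr t) < ε ∧ dist (u t) (ur t) < ε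

end ControlSystems

/-- The state-space model of the controlled cylinder: `x 0` is the transverse displacement, `x 1`
the transverse velocity, and the nominal input gain is `b = 1 / m`. -/
noncomputable def vivSystem (m K : ℝ) (fL Δ₁ : (Fin 2 → ℝ) → ℝ) (Δ₂ : ℝ → ℝ)
    (x : Fin 2 → ℝ) (u : ℝ) : Fin 2 → ℝ :=
  ![x 1, (fL x - K * x 0) / m + Δ₁ x + (1 / m + Δ₂ u) * u]

/-- The drift vector field `f`. -/
noncomputable def vivDrift (m K : ℝ) (fL Δ₁ : (Fin 2 → ℝ) → ℝ) (x : Fin 2 → ℝ) : Fin 2 → ℝ :=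
  ![x 1, (fL x - K * x 0) / m + Δ₁ x]

/-- The control vector field `g`, for the input value `u` occurring in the gain. -/
noncomputable def vivInput (m : ℝ) (Δ₂ : ℝ → ℝ) (u : ℝ) (_x : Fin 2 → ℝ) : Fin 2 → ℝ :=
  ![0, 1 / m + Δ₂ u]

theorem vivSystem_eq (m K : ℝ) (fL Δ₁ : (Fin 2 → ℝ) → ℝ) (Δ₂ : ℝ → ℝ)
    (x : Fin 2 → ℝ) (u : ℝ) :
    vivSystem m K fL Δ₁ Δ₂ x u = vivDrift m K fL Δ₁ x + u • vivInput m Δ₂ u x := by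
  ext i
  fin_cases i <;> simp [vivSystem, vivDrift, vivInput, mul_comm]

/-- The `2 × 2` matrix with columns `v` and `w`. -/
def colMatrix (v w : Fin 2 → ℝ) : Matrix (Fin 2) (Fin 2) ℝ :=
  (Matrix.of ![v, w]).transpose

/-- The Lie bracket `[f, g] = (∂f/∂x) g - (∂g/∂x) f`, with the sign opposite to that of
`VectorField.lieBracket`. -/
noncomputable def oppBracket (f g : (Fin 2 → ℝ) → (Fin 2 → ℝ)) (x : Fin 2 → ℝ) : Fin 2 → ℝ :=
  fderiv ℝ f x (g x) - fderiv ℝ g x (f x)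

/-! The plant has the form `x₀'' = F (x₀, x₀') + G u` with `G u = (b + Δ₂ u) * u`, so one may
prescribe the motion and solve for the input: a C² motion is realised once `x₀'' - F` takes values
where `G` has a continuous right inverse. To steer between perturbed end points, add to the
reference the cubic matching the end-point errors. The required value of `G` moves little, so a
local inverse suffices (`secondOrderSystem_locallyControllableAlong`). No Lie rank theorem is
needed; the bracket claims are a separate computation. The gain condition serves only to invert `G`:
near `0` because `G' 0 = b + Δ₂ 0`, globally if the gain is constant, and otherwise near some point
with `G' ≠ 0` (`exists_deriv_mul_self_ne_zero`). In that last case two points are linked by steering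
both to the end of one short trajectory (`locallyWeaklyControllableAt_of_along`). -/

/-- The scalar second-order system `x₀'' = F (x₀, x₀') + G u`, written in state space. -/
def secondOrderSystem (F : (Fin 2 → ℝ) → ℝ) (G : ℝ → ℝ) (x : Fin 2 → ℝ) (u : ℝ) : Fin 2 → ℝ :=
  ![x 1, F x + G u]

theorem vivSystem_eq_secondOrderSystem (m K : ℝ) (fL Δ₁ : (Fin 2 → ℝ) → ℝ) (Δ₂ : ℝ → ℝ) :
    vivSystem m K fL Δ₁ Δ₂ =
      secondOrderSystem (fun x => (fL x - K * x 0) / m + Δ₁ x) (fun u => (1 / m + Δ₂ u) * u) :=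
  rfl

theorem hasDerivWithinAt_fin_two {x : ℝ → Fin 2 → ℝ} {v : Fin 2 → ℝ} {s : Set ℝ} {t : ℝ} :
    HasDerivWithinAt x v s t ↔
      HasDerivWithinAt (fun τ => x τ 0) (v 0) s t ∧ HasDerivWithinAt (fun τ => x τ 1) (v 1) s t := by
  rw [hasDerivWithinAt_pi, Fin.forall_fin_two]

/-! ### Cubic Hermite interpolation -/

/-- The quadratic coefficient of the cubic Hermite interpolant on `[0, T]` whose value and slope
are `d` at `0` and `e` at `T`. -/
noncomputable def hermiteQuad (T : ℝ) (d e : Fin 2 → ℝ) : ℝ :=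
  (3 * (e 0 - d 0) - T * (2 * d 1 + e 1)) / T ^ 2

/-- The leading coefficient of the cubic Hermite interpolant on `[0, T]` whose value and slope
are `d` at `0` and `e` at `T`. -/
noncomputable def hermiteCube (T : ℝ) (d e : Fin 2 → ℝ) : ℝ :=
  (T * (d 1 + e 1) - 2 * (e 0 - d 0)) / T ^ 3

/-- The value and the slope of the cubic Hermite interpolant. -/
noncomputable def hermite (T : ℝ) (d e : Fin 2 → ℝ) (t : ℝ) : Fin 2 → ℝ :=
  ![d 0 + d 1 * t + hermiteQuad T d e * t ^ 2 + hermiteCube T d e * t ^ 3,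
    d 1 + 2 * hermiteQuad T d e * t + 3 * hermiteCube T d e * t ^ 2]

/-- The second derivative of the cubic Hermite interpolant. -/
noncomputable def hermiteAcc (T : ℝ) (d e : Fin 2 → ℝ) (t : ℝ) : ℝ :=
  2 * hermiteQuad T d e + 6 * hermiteCube T d e * t

theorem hermite_left (T : ℝ) (d e : Fin 2 → ℝ) : hermite T d e 0 = d := by
  ext i
  fin_cases i <;> simp [hermite]

theorem hermite_right {T : ℝ} (hT : T ≠ 0) (d e : Fin 2 → ℝ) : hermite T d e T = e := by
  ext i
  fin_cases i
  · simp only [hermite, hermiteQuad, hermiteCube, Fin.zero_eta, Matrix.cons_val_zero]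
    field_simp
    ring
  · simp only [hermite, hermiteQuad, hermiteCube, Fin.mk_one, Matrix.cons_val_one,
      Matrix.cons_val_zero]
    field_simp
    ring

theorem hermite_zero (T t : ℝ) : hermite T 0 0 t = 0 := by
  ext i
  fin_cases i <;> simp [hermite, hermiteQuad, hermiteCube]

theorem hermiteAcc_zero (T t : ℝ) : hermiteAcc T 0 0 t = 0 := by
  simp [hermiteAcc, hermiteQuad, hermiteCube]

theorem hasDerivAt_hermite (T : ℝ) (d e : Fin 2 → ℝ) (t : ℝ) :
    HasDerivAt (hermite T d e) ![hermite T d e t 1, hermiteAcc T d e t] t := by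
  rw [← hasDerivWithinAt_univ, hasDerivWithinAt_fin_two]
  simp only [hasDerivWithinAt_univ, hermite, hermiteAcc, Matrix.cons_val_zero,
    Matrix.cons_val_one]
  have h1 := hasDerivAt_id' t
  have h2 := hasDerivAt_pow 2 t
  have h3 := hasDerivAt_pow 3 t
  constructor
  · refine ((((hasDerivAt_const t (d 0)).add (h1.const_mul (d 1))).add
      (h2.const_mul (hermiteQuad T d e))).add (h3.const_mul (hermiteCube T d e))).congr_deriv ?_
    push_cast
    ring
  · refine (((hasDerivAt_const t (d 1)).add (h1.const_mul (2 * hermiteQuad T d e))).add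
      (h2.const_mul (3 * hermiteCube T d e))).congr_deriv ?_
    push_cast
    ring

theorem Continuous.hermite {X : Type*} [TopologicalSpace X] {d e : X → Fin 2 → ℝ} {t : X → ℝ}
    (T : ℝ) (hd : Continuous d) (he : Continuous e) (ht : Continuous t) :
    Continuous fun z => hermite T (d z) (e z) (t z) := by
  refine continuous_pi (Fin.forall_fin_two.2 ⟨?_, ?_⟩) <;>
    simp only [_root_.hermite, hermiteQuad, hermiteCube, Matrix.cons_val_zero,
      Matrix.cons_val_one] <;>
    fun_prop

theorem Continuous.hermiteAcc {X : Type*} [TopologicalSpace X] {d e : X → Fin 2 → ℝ} {t : X → ℝ}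
    (T : ℝ) (hd : Continuous d) (he : Continuous e) (ht : Continuous t) :
    Continuous fun z => hermiteAcc T (d z) (e z) (t z) := by
  simp only [_root_.hermiteAcc, hermiteQuad, hermiteCube]
  fun_prop

/-! ### Controllability along a trajectory -/

/-- A second-order system with continuous right-hand side is locally controllable along a
trajectory near whose inputs the input map `G` has a continuous right inverse `ψ`. -/
theorem secondOrderSystem_locallyControllableAlong {F : (Fin 2 → ℝ) → ℝ} {G ψ : ℝ → ℝ}
    {V : Set ℝ} (hF : Continuous F) (hG : Continuous G) (hV : IsOpen V) (hψ : ContinuousOn ψ V)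
    (hGψ : ∀ v ∈ V, G (ψ v) = v) {T : ℝ} (hT : 0 < T) {xr : ℝ → Fin 2 → ℝ} {ur : ℝ → ℝ}
    (htraj : IsTrajectory (secondOrderSystem F G) T xr ur)
    (hmem : ∀ t ∈ Icc 0 T, G (ur t) ∈ V) (hinv : ∀ t ∈ Icc 0 T, ψ (G (ur t)) = ur t) :
    LocallyControllableAlong (secondOrderSystem F G) T xr ur := by
  intro ε hε
  obtain ⟨hur, hxr⟩ := htraj
  have hxrc : ContinuousOn xr (Icc 0 T) := fun t ht => (hxr t ht).continuousWithinAt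
  have hxr' : Continuous fun t : Icc (0 : ℝ) T => xr t := hxrc.domRestrict
  have hur' : Continuous fun t : Icc (0 : ℝ) T => ur t := hur.domRestrict
  -- For end points `θ`, `X θ` is the corrected motion and `W θ` the value that `G u` must take
  -- along it.
  let X : (Fin 2 → ℝ) × (Fin 2 → ℝ) → ℝ → Fin 2 → ℝ := fun θ t =>
    xr t + hermite T (θ.1 - xr 0) (θ.2 - xr T) t
  let W : (Fin 2 → ℝ) × (Fin 2 → ℝ) → ℝ → ℝ := fun θ t =>
    F (xr t) + G (ur t) + hermiteAcc T (θ.1 - xr 0) (θ.2 - xr T) t - F (X θ t)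
  have hX : Continuous fun z : ((Fin 2 → ℝ) × (Fin 2 → ℝ)) × Icc (0 : ℝ) T => X z.1 z.2 :=
    (hxr'.comp continuous_snd).add
      (Continuous.hermite T (by fun_prop) (by fun_prop) (by fun_prop))
  have hW : Continuous fun z : ((Fin 2 → ℝ) × (Fin 2 → ℝ)) × Icc (0 : ℝ) T => W z.1 z.2 :=
    ((((hF.comp (hxr'.comp continuous_snd)).add (hG.comp (hur'.comp continuous_snd))).add
      (Continuous.hermiteAcc T (by fun_prop) (by fun_prop) (by fun_prop))).sub (hF.comp hX))
  have hX0 : ∀ t, X (xr 0, xr T) t = xr t := fun t => by simp [X, hermite_zero]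
  have hW0 : ∀ t, W (xr 0, xr T) t = G (ur t) := fun t => by
    simp only [W, hX0, sub_self, hermiteAcc_zero]
    ring
  -- Compactness of `[0, T]` makes the neighbourhood of the reference end points uniform in `t`.
  have key : ∀ᶠ θ in 𝓝 (xr 0, xr T), ∀ t ∈ (univ : Set (Icc (0 : ℝ) T)),
      W θ t ∈ V ∧ dist (X θ t) (xr t) < ε ∧ dist (ψ (W θ t)) (ur t) < ε := by
    refine isCompact_univ.eventually_forall_of_forall_eventually fun t _ => ?_
    have hWV : V ∈ 𝓝 (W (xr 0, xr T) t) := hV.mem_nhds (by rw [hW0]; exact hmem t t.2)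
    have h1 := (hW.continuousAt (x := ((xr 0, xr T), t))).eventually_mem hWV
    have h2 : ∀ᶠ z : ((Fin 2 → ℝ) × (Fin 2 → ℝ)) × Icc (0 : ℝ) T in 𝓝 ((xr 0, xr T), t),
        dist (X z.1 z.2) (xr z.2) < ε := by
      refine ContinuousAt.eventually_lt
        ((hX.dist (hxr'.comp continuous_snd)).continuousAt) continuousAt_const ?_
      simpa [hX0] using hε
    have h3 : ∀ᶠ z : ((Fin 2 → ℝ) × (Fin 2 → ℝ)) × Icc (0 : ℝ) T in 𝓝 ((xr 0, xr T), t),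
        dist (ψ (W z.1 z.2)) (ur z.2) < ε := by
      refine ContinuousAt.eventually_lt (Filter.Tendsto.dist
        (ContinuousAt.comp (f := fun z : ((Fin 2 → ℝ) × (Fin 2 → ℝ)) × Icc (0 : ℝ) T => W z.1 z.2)
          (hψ.continuousAt hWV) hW.continuousAt)
        (hur'.comp continuous_snd).continuousAt) continuousAt_const ?_
      simpa [hW0, hinv t t.2] using hε
    exact h1.and (h2.and h3)
  obtain ⟨δ, hδ, hball⟩ := Metric.eventually_nhds_iff.1 key
  refine ⟨δ, hδ, fun a c ha hc => ?_⟩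
  have hθ : ∀ t ∈ Icc 0 T, W (a, c) t ∈ V ∧ dist (X (a, c) t) (xr t) < ε ∧
      dist (ψ (W (a, c) t)) (ur t) < ε := fun t ht =>
    hball (y := (a, c)) (by rw [Prod.dist_eq]; exact max_lt ha hc) ⟨t, ht⟩ (mem_univ _)
  refine ⟨X (a, c), fun t => ψ (W (a, c) t), ⟨?_, fun t ht => ?_⟩, ?_, ?_,
    fun t ht => (hθ t ht).2⟩
  · refine hψ.comp ?_ fun t ht => (hθ t ht).1
    rw [continuousOn_iff_continuous_domRestrict]
    exact hW.comp (Continuous.prodMk_right (a, c))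
  · refine ((hxr t ht).add (hasDerivAt_hermite T _ _ t).hasDerivWithinAt).congr_deriv ?_
    ext i
    fin_cases i
    · simp [secondOrderSystem, X]
    · simp only [secondOrderSystem, Fin.mk_one, Pi.add_apply, Matrix.cons_val_one,
        Matrix.cons_val_zero, hGψ _ (hθ t ht).1, W]
      ring
  · simp [X, hermite_left]
  · simp [X, hermite_right hT.ne']

/-! ### From trajectories to points -/

/-- Local controllability along an equilibrium motion gives local controllability at the
equilibrium. -/
theorem LocallyControllableAlong.locallyControllableAt {E : Type*} [NormedAddCommGroup E]
    [NormedSpace ℝ E] {F : E → ℝ → E} {T : ℝ} (hT : 0 ≤ T) {x₀ : E} {ur : ℝ → ℝ}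
    (h : LocallyControllableAlong F T (fun _ => x₀) ur) : LocallyControllableAt F x₀ := by
  intro U hU
  obtain ⟨ε, hε, hεU⟩ := Metric.mem_nhds_iff.1 hU
  obtain ⟨δ, hδ, H⟩ := h ε hε
  refine Metric.mem_nhds_iff.2 ⟨δ, hδ, fun c hc => ?_⟩
  obtain ⟨x, u, hx, hx0, hxT, hclose⟩ := H x₀ c (by simpa using hδ) hc
  exact ⟨T, hT, x, u, hx, hx0, hxT, fun t ht => hεU (hclose t ht).1⟩

/-- Local weak controllability holds at `x₀` if, inside every neighbourhood of `x₀`, there is a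
trajectory from `x₀` along which the system is locally controllable. -/
theorem locallyWeaklyControllableAt_of_along {E : Type*} [NormedAddCommGroup E]
    [NormedSpace ℝ E] {F : E → ℝ → E} {x₀ : E}
    (h : ∀ U ∈ 𝓝 x₀, ∃ T : ℝ, 0 ≤ T ∧ ∃ (xr : ℝ → E) (ur : ℝ → ℝ), xr 0 = x₀ ∧
      (∀ t ∈ Icc 0 T, xr t ∈ U) ∧ IsTrajectory F T xr ur ∧ LocallyControllableAlong F T xr ur) :
    LocallyWeaklyControllableAt F x₀ := by
  intro U hU
  -- Passing to the open set `interior U` leaves room for a tube around the compact reference arc.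
  obtain ⟨T, hT, xr, ur, h0, hxU, htraj, hloc⟩ := h (interior U) (interior_mem_nhds.2 hU)
  have hxc : ContinuousOn xr (Icc 0 T) := fun t ht => (htraj.2 t ht).continuousWithinAt
  obtain ⟨ε, hε, hεU⟩ := (isCompact_Icc.image_of_continuousOn hxc).exists_thickening_subset_open
    isOpen_interior (image_subset_iff.2 hxU)
  obtain ⟨δ, hδ, H⟩ := hloc ε hε
  refine Metric.mem_nhds_iff.2 ⟨δ, hδ, fun c hc => ?_⟩
  -- Only the starting point is perturbed: `c` and `x₀` are both steered to `xr T`.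
  obtain ⟨x, u, hx, hx0, hxT, hclose⟩ := H c (xr T) (by rw [h0]; exact hc) (by simpa using hδ)
  have hcU : ReachableWithin F U c (xr T) := ⟨T, hT, x, u, hx, hx0, hxT, fun t ht =>
    interior_subset (hεU (Metric.mem_thickening_iff.2
      ⟨xr t, mem_image_of_mem xr ht, (hclose t ht).1⟩))⟩
  have hx₀U : ReachableWithin F U x₀ (xr T) :=
    ⟨T, hT, xr, ur, htraj, h0, rfl, fun t ht => interior_subset (hxU t ht)⟩
  exact (Relation.EqvGen.rel _ _ hx₀U).trans _ _ _ ((Relation.EqvGen.rel _ _ hcU).symm _ _)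

/-- A function with nonzero strict derivative has a continuous local inverse. -/
theorem HasStrictDerivAt.exists_continuousOn_inverse {G : ℝ → ℝ} {G' u₀ : ℝ}
    (h : HasStrictDerivAt G G' u₀) (hG' : G' ≠ 0) :
    ∃ (V : Set ℝ) (ψ : ℝ → ℝ), IsOpen V ∧ G u₀ ∈ V ∧ ContinuousOn ψ V ∧
      (∀ v ∈ V, G (ψ v) = v) ∧ ψ (G u₀) = u₀ := by
  have hf := h.hasStrictFDerivAt_equiv hG'
  let e := hf.toOpenPartialHomeomorph G
  have he : (e : ℝ → ℝ) = G := hf.toOpenPartialHomeomorph_coe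
  have hs : u₀ ∈ e.source := hf.mem_toOpenPartialHomeomorph_source
  refine ⟨e.target, e.symm, e.open_target, hf.image_mem_toOpenPartialHomeomorph_target,
    e.continuousOn_symm, fun v hv => ?_, ?_⟩
  · rw [← he]
    exact e.right_inv hv
  · rw [← he]
    exact e.left_inv hs

/-- A second-order system whose input map has a nonzero strict derivative somewhere is locally
weakly controllable everywhere. -/
theorem secondOrderSystem_locallyWeaklyControllableAt {F : (Fin 2 → ℝ) → ℝ} {G : ℝ → ℝ}
    {G' u₀ : ℝ} (hF : Continuous F) (hG : Continuous G) (h : HasStrictDerivAt G G' u₀)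
    (hG' : G' ≠ 0) (x₀ : Fin 2 → ℝ) :
    LocallyWeaklyControllableAt (secondOrderSystem F G) x₀ := by
  obtain ⟨V, ψ, hV, hmem, hψ, hGψ, -⟩ := h.exists_continuousOn_inverse hG'
  refine locallyWeaklyControllableAt_of_along fun U hU => ?_
  -- With constant acceleration `A` the required value of `G` is `A - F (xr t)`. It equals `G u₀` at
  -- `t = 0`, so it stays in `V` for short times.
  let A := F x₀ + G u₀
  let xr : ℝ → Fin 2 → ℝ := fun t => ![x₀ 0 + x₀ 1 * t + A / 2 * t ^ 2, x₀ 1 + A * t]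
  have hxr : Continuous xr := by
    refine continuous_pi (Fin.forall_fin_two.2 ⟨?_, ?_⟩) <;>
      simp only [xr, Matrix.cons_val_zero, Matrix.cons_val_one] <;> fun_prop
  have hxr0 : xr 0 = x₀ := by
    ext i
    fin_cases i <;> simp [xr]
  have hw : Continuous fun t => A - F (xr t) := continuous_const.sub (hF.comp hxr)
  have hev : ∀ᶠ t in 𝓝 (0 : ℝ), xr t ∈ U ∧ A - F (xr t) ∈ V :=
    (hxr.continuousAt.eventually_mem (by rwa [hxr0])).and
      (hw.continuousAt.eventually_mem (hV.mem_nhds (by simpa [hxr0, A] using hmem)))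
  obtain ⟨r, hr, hball⟩ := Metric.eventually_nhds_iff.1 hev
  have hIcc : ∀ t ∈ Icc 0 (r / 2), xr t ∈ U ∧ A - F (xr t) ∈ V := fun t ht =>
    hball (by rw [Real.dist_eq, sub_zero, abs_of_nonneg ht.1]; linarith [ht.2])
  have htraj : IsTrajectory (secondOrderSystem F G) (r / 2) xr fun t => ψ (A - F (xr t)) := by
    refine ⟨hψ.comp hw.continuousOn fun t ht => (hIcc t ht).2, fun t ht => ?_⟩
    rw [hasDerivWithinAt_fin_two]
    simp only [secondOrderSystem, hGψ _ (hIcc t ht).2, xr, Matrix.cons_val_zero,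
      Matrix.cons_val_one]
    have h1 := hasDerivAt_id' t
    constructor
    · refine ((((hasDerivAt_const t (x₀ 0)).add (h1.const_mul (x₀ 1))).add
        ((hasDerivAt_pow 2 t).const_mul (A / 2))).congr_deriv ?_).hasDerivWithinAt
      push_cast
      ring
    · refine (((hasDerivAt_const t (x₀ 1)).add (h1.const_mul A)).congr_deriv ?_).hasDerivWithinAt
      ring
  refine ⟨r / 2, by positivity, xr, _, hxr0, fun t ht => (hIcc t ht).1, htraj, ?_⟩
  refine secondOrderSystem_locallyControllableAlong hF hG hV hψ hGψ (by positivity) htraj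
    (fun t ht => ?_) fun t ht => ?_
  · rw [hGψ _ (hIcc t ht).2]
    exact (hIcc t ht).2
  -- The reference input is itself a value of `ψ`, so the right-inverse property alone gives `ψ (G
  -- (ur t)) = ur t`.
  · rw [hGψ _ (hIcc t ht).2]

theorem isTrajectory_const {E : Type*} [NormedAddCommGroup E] [NormedSpace ℝ E] {F : E → ℝ → E}
    (T : ℝ) {x₀ : E} {u₀ : ℝ} (h : F x₀ u₀ = 0) :
    IsTrajectory F T (fun _ => x₀) fun _ => u₀ :=
  ⟨continuousOn_const, fun t _ => by rw [h]; exact hasDerivWithinAt_const t _ x₀⟩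

/-- A gain map `u ↦ k u * u` that is not identically zero has a nonzero derivative somewhere. -/
theorem exists_deriv_mul_self_ne_zero {k : ℝ → ℝ} (hk : Differentiable ℝ k) {u : ℝ}
    (hu : k u ≠ 0) : ∃ u₀, deriv (fun v => k v * v) u₀ ≠ 0 := by
  -- Otherwise `k v * v` is constantly `0`, forcing `u = 0`; but its derivative at `0` is `k 0`.
  by_contra! hzero
  have hconst := is_const_of_deriv_eq_zero (hk.mul differentiable_id) hzero u 0
  have hu0 : u = 0 := by simpa [hu] using hconst
  have h0 := ((hk 0).hasDerivAt.mul (hasDerivAt_id' 0)).deriv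
  rw [show (k * fun v => v) = fun v => k v * v from rfl, hzero 0] at h0
  simp only [mul_zero, mul_one, zero_add] at h0
  exact hu (by rw [hu0, ← h0])

/-! ### Bracket, determinant and rank -/

theorem colMatrix_det (v w : Fin 2 → ℝ) : (colMatrix v w).det = v 0 * w 1 - w 0 * v 1 := by
  simp [colMatrix, Matrix.det_fin_two]
  ring

theorem rank_eq_two_iff_det_ne_zero (A : Matrix (Fin 2) (Fin 2) ℝ) : A.rank = 2 ↔ A.det ≠ 0 := by
  rw [← isUnit_iff_ne_zero, ← Matrix.isUnit_iff_isUnit_det,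
    ← Matrix.linearIndependent_rows_iff_isUnit, linearIndependent_iff_card_eq_finrank_span,
    Set.finrank, A.rank_eq_finrank_span_row, Fintype.card_fin, eq_comm]

/-- The input field does not depend on `x`, so only the drift derivative in the velocity direction
survives. -/
theorem oppBracket_vivDrift_vivInput (m K : ℝ) {fL Δ₁ : (Fin 2 → ℝ) → ℝ} (Δ₂ : ℝ → ℝ)
    (hfL : Differentiable ℝ fL) (hΔ₁ : Differentiable ℝ Δ₁) (x : Fin 2 → ℝ) (u : ℝ) :
    oppBracket (vivDrift m K fL Δ₁) (vivInput m Δ₂ u) x =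
      ![1 / m + Δ₂ u, (1 / m + Δ₂ u) *
        (1 / m * fderiv ℝ fL x (Pi.single 1 1) + fderiv ℝ Δ₁ x (Pi.single 1 1))] := by
  have hpr : ∀ i : Fin 2, HasFDerivAt (fun y : Fin 2 → ℝ => y i)
      (ContinuousLinearMap.proj (R := ℝ) (φ := fun _ : Fin 2 => ℝ) i) x :=
    fun i => hasFDerivAt_apply i x
  have hdrift : HasFDerivAt (vivDrift m K fL Δ₁) (ContinuousLinearMap.pi
      ![ContinuousLinearMap.proj (R := ℝ) (φ := fun _ : Fin 2 => ℝ) 1,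
        m⁻¹ • (fderiv ℝ fL x - K • ContinuousLinearMap.proj (R := ℝ) (φ := fun _ : Fin 2 => ℝ) 0) +
          fderiv ℝ Δ₁ x]) x := by
    rw [hasFDerivAt_pi, Fin.forall_fin_two]
    refine ⟨hpr 1, ?_⟩
    have h := (((hfL x).hasFDerivAt.sub ((hpr 0).const_mul K)).const_mul m⁻¹).add
      (hΔ₁ x).hasFDerivAt
    refine h.congr_of_eventuallyEq (Filter.Eventually.of_forall fun y => ?_)
    simp [vivDrift, div_eq_inv_mul]
  have hinput : fderiv ℝ (vivInput m Δ₂ u) x = 0 := by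
    rw [show vivInput m Δ₂ u = fun _ => ![0, 1 / m + Δ₂ u] from rfl, fderiv_fun_const]
    rfl
  have hvec : vivInput m Δ₂ u x = (1 / m + Δ₂ u) • Pi.single (1 : Fin 2) (1 : ℝ) := by
    ext i
    fin_cases i <;> simp [vivInput]
  rw [oppBracket, hinput, hdrift.fderiv, hvec, map_smul]
  ext i
  fin_cases i <;> simp

theorem lieBracket_eq_neg_oppBracket (f g : (Fin 2 → ℝ) → (Fin 2 → ℝ)) (x : Fin 2 → ℝ) :
    VectorField.lieBracket ℝ f g x = -oppBracket f g x := by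
  rw [VectorField.lieBracket, oppBracket, neg_sub]

theorem mainTheorem1 (m K : ℝ) (hm : 0 < m) (fL Δ₁ : (Fin 2 → ℝ) → ℝ) (Δ₂ : ℝ → ℝ)
    (hfL : ContDiff ℝ 1 fL) (hΔ₁ : ContDiff ℝ 1 Δ₁) (hΔ₂ : ContDiff ℝ 1 Δ₂) :
    -- the Lie bracket, and the determinant and rank of `M = [g, [f, g]]`, for either sign
    -- convention of the bracket
    (∀ (x : Fin 2 → ℝ) (u : ℝ),
      oppBracket (vivDrift m K fL Δ₁) (vivInput m Δ₂ u) x =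
          ![1 / m + Δ₂ u, (1 / m + Δ₂ u) *
            (1 / m * fderiv ℝ fL x (Pi.single 1 1) + fderiv ℝ Δ₁ x (Pi.single 1 1))] ∧
      (colMatrix (vivInput m Δ₂ u x)
          (oppBracket (vivDrift m K fL Δ₁) (vivInput m Δ₂ u) x)).det = -(1 / m + Δ₂ u) ^ 2 ∧
      (colMatrix (vivInput m Δ₂ u x)
          (VectorField.lieBracket ℝ (vivDrift m K fL Δ₁) (vivInput m Δ₂ u) x)).det =
            (1 / m + Δ₂ u) ^ 2 ∧
      ((colMatrix (vivInput m Δ₂ u x)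
          (oppBracket (vivDrift m K fL Δ₁) (vivInput m Δ₂ u) x)).rank = 2 ↔ Δ₂ u ≠ -(1 / m)) ∧
      ((colMatrix (vivInput m Δ₂ u x)
          (VectorField.lieBracket ℝ (vivDrift m K fL Δ₁) (vivInput m Δ₂ u) x)).rank = 2 ↔
            Δ₂ u ≠ -(1 / m))) ∧
    -- local weak controllability around every state
    (∀ u : ℝ, Δ₂ u ≠ -(1 / m) →
      ∀ x₀ : Fin 2 → ℝ, LocallyWeaklyControllableAt (vivSystem m K fL Δ₁ Δ₂) x₀) ∧
    -- local controllability along the unforced motions and at the unforced equilibria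
    (Δ₂ 0 ≠ -(1 / m) →
      (∀ (T : ℝ) (xr : ℝ → Fin 2 → ℝ), 0 < T →
        IsTrajectory (vivSystem m K fL Δ₁ Δ₂) T xr (fun _ => 0) →
        LocallyControllableAlong (vivSystem m K fL Δ₁ Δ₂) T xr (fun _ => 0)) ∧
      (∀ x₀ : Fin 2 → ℝ, vivDrift m K fL Δ₁ x₀ = 0 →
        LocallyControllableAt (vivSystem m K fL Δ₁ Δ₂) x₀)) ∧
    -- for an input-independent gain: local controllability along every trajectory, and at every
    -- state of zero velocity
    (∀ d : ℝ, (∀ u : ℝ, Δ₂ u = d) → d ≠ -(1 / m) →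
      (∀ (T : ℝ) (xr : ℝ → Fin 2 → ℝ) (ur : ℝ → ℝ), 0 < T →
        IsTrajectory (vivSystem m K fL Δ₁ Δ₂) T xr ur →
        LocallyControllableAlong (vivSystem m K fL Δ₁ Δ₂) T xr ur) ∧
      (∀ x₀ : Fin 2 → ℝ, x₀ 1 = 0 →
        LocallyControllableAt (vivSystem m K fL Δ₁ Δ₂) x₀)) := by
  have hfLc := hfL.continuous
  have hΔ₁c := hΔ₁.continuous
  have hΔ₂c := hΔ₂.continuous
  have hne : ∀ r : ℝ, r ≠ -(1 / m) ↔ 1 / m + r ≠ 0 := fun r =>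
    not_congr (by rw [add_comm, add_eq_zero_iff_eq_neg])
  have hF : Continuous fun x : Fin 2 → ℝ => (fL x - K * x 0) / m + Δ₁ x := by fun_prop
  have hG : Continuous fun u : ℝ => (1 / m + Δ₂ u) * u := by fun_prop
  have hGdiff : ContDiff ℝ 1 fun u : ℝ => (1 / m + Δ₂ u) * u :=
    (contDiff_const.add hΔ₂).mul contDiff_id
  have hstrict : ∀ u, HasStrictDerivAt (fun u : ℝ => (1 / m + Δ₂ u) * u)
      (deriv (fun u : ℝ => (1 / m + Δ₂ u) * u) u) u := fun u =>
    hGdiff.contDiffAt.hasStrictDerivAt one_ne_zero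
  have hk : Differentiable ℝ fun u => 1 / m + Δ₂ u :=
    (hΔ₂.differentiable one_ne_zero).const_add _
  refine ⟨fun x u => ?_, fun u hu x₀ => ?_, fun h0 => ?_, fun d hd hdne => ?_⟩
  · have hbr := oppBracket_vivDrift_vivInput m K Δ₂ (hfL.differentiable one_ne_zero)
      (hΔ₁.differentiable one_ne_zero) x u
    have hdet : (colMatrix (vivInput m Δ₂ u x)
        (oppBracket (vivDrift m K fL Δ₁) (vivInput m Δ₂ u) x)).det = -(1 / m + Δ₂ u) ^ 2 := by
      rw [colMatrix_det, hbr]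
      simp [vivInput]
      ring
    have hdet' : (colMatrix (vivInput m Δ₂ u x)
        (VectorField.lieBracket ℝ (vivDrift m K fL Δ₁) (vivInput m Δ₂ u) x)).det =
          (1 / m + Δ₂ u) ^ 2 := by
      rw [colMatrix_det, lieBracket_eq_neg_oppBracket, hbr]
      simp [vivInput]
      ring
    refine ⟨hbr, hdet, hdet', ?_, ?_⟩
    · rw [rank_eq_two_iff_det_ne_zero, hdet, hne, neg_ne_zero, pow_ne_zero_iff two_ne_zero]
    · rw [rank_eq_two_iff_det_ne_zero, hdet', hne, pow_ne_zero_iff two_ne_zero]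
  · obtain ⟨u₀, hu₀⟩ := exists_deriv_mul_self_ne_zero hk ((hne _).1 hu)
    rw [vivSystem_eq_secondOrderSystem]
    exact secondOrderSystem_locallyWeaklyControllableAt hF hG (hstrict u₀) hu₀ x₀
  -- The term with `Δ₂'` carries the factor `u = 0`. A single local inverse serves all unforced
  -- motions, since their input is always `0`.
  · have hderiv : deriv (fun u : ℝ => (1 / m + Δ₂ u) * u) 0 = 1 / m + Δ₂ 0 := by
      simpa using ((hk 0).hasDerivAt.fun_mul (hasDerivAt_id' 0)).deriv
    obtain ⟨V, ψ, hV, hmem, hψ, hGψ, hinv⟩ :=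
      (hstrict 0).exists_continuousOn_inverse (by rw [hderiv]; exact (hne _).1 h0)
    have hlocal : ∀ (T : ℝ) (xr : ℝ → Fin 2 → ℝ), 0 < T →
        IsTrajectory (vivSystem m K fL Δ₁ Δ₂) T xr (fun _ => 0) →
        LocallyControllableAlong (vivSystem m K fL Δ₁ Δ₂) T xr (fun _ => 0) :=
      fun T xr hT htraj => secondOrderSystem_locallyControllableAlong hF hG hV hψ hGψ hT htraj
        (fun _ _ => hmem) fun _ _ => hinv
    refine ⟨hlocal, fun x₀ hx₀ => ?_⟩
    exact (hlocal 1 _ one_pos (isTrajectory_const 1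
      (by rw [vivSystem_eq, hx₀, zero_smul, add_zero]))).locallyControllableAt zero_le_one
  · have hk0 : 1 / m + d ≠ 0 := (hne d).1 hdne
    have hlocal : ∀ (T : ℝ) (xr : ℝ → Fin 2 → ℝ) (ur : ℝ → ℝ), 0 < T →
        IsTrajectory (vivSystem m K fL Δ₁ Δ₂) T xr ur →
        LocallyControllableAlong (vivSystem m K fL Δ₁ Δ₂) T xr ur :=
      fun T xr ur hT htraj => secondOrderSystem_locallyControllableAlong
        (ψ := fun v => v / (1 / m + d)) hF hG isOpen_univ (by fun_prop)
        (fun v _ => by rw [hd, mul_div_cancel₀ _ hk0]) hT htraj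
        (fun _ _ => mem_univ _) fun t _ => by rw [hd, mul_div_cancel_left₀ _ hk0]
    refine ⟨hlocal, fun x₀ hx₀ => ?_⟩
    -- This constant input cancels the drift acceleration, making `x₀` a forced equilibrium.
    refine (hlocal 1 _ (fun _ => -((fL x₀ - K * x₀ 0) / m + Δ₁ x₀) / (1 / m + d)) one_pos
      (isTrajectory_const 1 ?_)).locallyControllableAt zero_le_one
    rw [vivSystem, hd, mul_div_cancel₀ _ hk0, hx₀, add_neg_cancel]
    ext i
    fin_cases i <;> rfl
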